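/- For real $a,b,c$ with $c\ne 0,-1,-2,\dots$ let $F(a,b;c;z)=\sum_{n\ge 0}\frac{(a)_n(b)_n}{(c)_n}\frac{z^n}{n!}$, $|z|<1$, be the Gaussian hypergeometric function, where $(a)_0=1$ and $(a)_n=a(a+1)\cdots(a+n-1)$. For $z\in(0,1)$ put $u(z)=F(a-1,b;c;z)$, $v(z)=F(a,b;c;z)$, $u_1(z)=u(1-z)$, $v_1(z)=v(1-z)$. Let $a,b>0$, $c\ge 1$ and $2c=a+b+1$. Then a constant $A$ satisfies $$(c-a)(uv_1+u_1v)+(a-1)vv_1=A\,z^{1-c}(1-z)^{1-c}\qquad\text{for all } z\in(0,1)$$ if and only if $$A=\frac{\Gamma(c)^2}{\Gamma(a)\Gamma(b)};$$ in particular, the identity holds with this value of $A$. If moreover $c=1$ (so that $0<a<1$ and $b=1-a$), the identity reduces to Legendre's relation for generalized elliptic integrals. Namely, for $r\in(0,1)$ and $r'=\sqrt{1-r^2}$ let $$\mathcal K_a(r)=\tfrac{\pi}{2}F(a,1-a;1;r^2),\quad \mathcal E_a(r)=\tfrac{\pi}{2}F(a-1,1-a;1;r^2),\quad \mathcal K_a'(r)=\mathcal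 K_a(r'),\quad \mathcal E_a'(r)=\mathcal E_a(r').$$ Then, for every $r\in(0,1)$, the left side of the identity at $z=r^2$ equals $(1-a)\left(\tfrac{2}{\pi}\right)^2\left(\mathcal E_a\mathcal K_a'+\mathcal E_a'\mathcal K_a-\mathcal K_a\mathcal K_a'\right)(r)$, and $$\mathcal E_a\mathcal K_a'+\mathcal E_a'\mathcal K_a-\mathcal K_a\mathcal K_a'=\frac{\pi\sin(\pi a)}{4(1-a)}.$$ -/

import Mathlib

noncomputable section

/-- `u(z) = F(a-1, b; c; z)`, where `F` is the Gaussian hypergeometric function. -/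
def hypU (a b c z : ℝ) : ℝ := ordinaryHypergeometric (a - 1) b c z

/-- `v(z) = F(a, b; c; z)`. -/
def hypV (a b c z : ℝ) : ℝ := ordinaryHypergeometric a b c z

/-- The expression `(c-a)(u v₁ + u₁ v) + (a-1) v v₁` at `z`, where `u₁(z) = u(1-z)` and
`v₁(z) = v(1-z)`. -/
def legendreForm (a b c z : ℝ) : ℝ :=
  (c - a) * (hypU a b c z * hypV a b c (1 - z) + hypU a b c (1 - z) * hypV a b c z)
    + (a - 1) * (hypV a b c z * hypV a b c (1 - z))

/-- The generalized elliptic integral of the first kind, `K_a(r) = (π/2) F(a, 1-a; 1; r²)`. -/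
def genEllipticK (a r : ℝ) : ℝ :=
  Real.pi / 2 * ordinaryHypergeometric a (1 - a) (1 : ℝ) (r ^ 2)

/-- The generalized elliptic integral of the second kind, `E_a(r) = (π/2) F(a-1, 1-a; 1; r²)`. -/
def genEllipticE (a r : ℝ) : ℝ :=
  Real.pi / 2 * ordinaryHypergeometric (a - 1) (1 - a) (1 : ℝ) (r ^ 2)

/-- `E_a K_a' + E_a' K_a - K_a K_a'` at `r`, where `K_a'(r) = K_a(r')`, `E_a'(r) = E_a(r')` and
`r' = √(1 - r²)`. -/
def genLegendre (a r : ℝ) : ℝ :=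
  genEllipticE a r * genEllipticK a (Real.sqrt (1 - r ^ 2))
    + genEllipticE a (Real.sqrt (1 - r ^ 2)) * genEllipticK a r
    - genEllipticK a r * genEllipticK a (Real.sqrt (1 - r ^ 2))

end

open Filter Topology Polynomial

/-! ### Coefficients of the hypergeometric series -/

/-! When `2 * c = a + b + 1`, the hypergeometric equation is invariant under `z ↦ 1 - z`, so `F(z)`
and `F(1 - z)` solve the same equation. The contiguous relation `ordinaryHypergeometric_contiguous`
turns the left side into `z (1 - z)` times their Wronskian (up to sign), and Abel's identity makes
`z ^ c * (1 - z) ^ c` times that Wronskian constant.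

The constant is the limit at `0`. It needs the growth of `F` and `F'` at `1`, which
`tendsto_div_powerSeries` extracts by comparing coefficients with those of the binomial series;
Euler's limit for `Γ` evaluates the coefficient ratios. Legendre's relation is the case `c = 1`, by
the reflection formula. -/

lemma ascPochhammer_succ_eval_left {R : Type*} [CommRing R] (n : ℕ) (s : R) :
    (ascPochhammer R (n + 1)).eval s = s * (ascPochhammer R n).eval (s + 1) := by
  simp [ascPochhammer_succ_left, eval_comp]

lemma ascPochhammer_eval_add_one {R : Type*} [CommRing R] (n : ℕ) (s : R) :
    s * (ascPochhammer R n).eval (s + 1) = (ascPochhammer R n).eval s * (s + n) := by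
  rw [← ascPochhammer_succ_eval_left, ascPochhammer_succ_eval]

lemma ordinaryHypergeometricCoefficient_zero (a b c : ℝ) :
    ordinaryHypergeometricCoefficient a b c 0 = 1 := by
  simp [ordinaryHypergeometricCoefficient]

lemma ordinaryHypergeometricCoefficient_succ {c : ℝ} (hc : 0 < c) (a b : ℝ) (n : ℕ) :
    ((n : ℝ) + 1) * (c + n) * ordinaryHypergeometricCoefficient a b c (n + 1)
      = (a + n) * (b + n) * ordinaryHypergeometricCoefficient a b c n := by
  have h1 := (ascPochhammer_pos n c hc).ne'
  have h2 : c + n ≠ 0 := by positivity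
  have h3 : (n.factorial : ℝ) ≠ 0 := by positivity
  simp only [ordinaryHypergeometricCoefficient, ascPochhammer_succ_eval, Nat.factorial_succ]
  push_cast
  field_simp

/-- Differentiating the hypergeometric series raises all three parameters by one. -/
lemma ordinaryHypergeometricCoefficient_add_one {c : ℝ} (hc : 0 < c) (a b : ℝ) (n : ℕ) :
    a * b / c * ordinaryHypergeometricCoefficient (a + 1) (b + 1) (c + 1) n
      = ((n : ℝ) + 1) * ordinaryHypergeometricCoefficient a b c (n + 1) := by
  have h1 := (ascPochhammer_pos n (c + 1) (by linarith)).ne'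
  have h3 : (n.factorial : ℝ) ≠ 0 := by positivity
  simp only [ordinaryHypergeometricCoefficient, ascPochhammer_succ_eval_left, Nat.factorial_succ]
  push_cast
  field_simp

lemma ordinaryHypergeometricCoefficient_sub_one_succ {c : ℝ} (hc : 0 < c) (a b : ℝ) (n : ℕ) :
    ((n : ℝ) + 1) * (c + n) * ordinaryHypergeometricCoefficient (a - 1) b c (n + 1)
      = (a - 1) * (b + n) * ordinaryHypergeometricCoefficient a b c n := by
  have h1 := (ascPochhammer_pos n c hc).ne'
  have h2 : c + n ≠ 0 := by positivity
  have h3 : (n.factorial : ℝ) ≠ 0 := by positivity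
  have h4 := ascPochhammer_succ_eval_left n (a - 1)
  rw [sub_add_cancel] at h4
  simp only [ordinaryHypergeometricCoefficient, h4, ascPochhammer_succ_eval n b,
    ascPochhammer_succ_eval n c, Nat.factorial_succ]
  push_cast
  field_simp

/-! ### The hypergeometric function on the unit interval -/

/-- If a parameter is a nonpositive integer, the coefficients eventually vanish; for `c` this uses
the convention `0⁻¹ = 0`. -/
lemma one_le_radius_ordinaryHypergeometricSeries (a b c : ℝ) :
    1 ≤ (ordinaryHypergeometricSeries ℝ a b c).radius := by
  by_cases h : ∀ k : ℕ, (k : ℝ) ≠ -a ∧ (k : ℝ) ≠ -b ∧ (k : ℝ) ≠ -c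
  · rw [ordinaryHypergeometricSeries_radius_eq_one ℝ a b c h]
  · push Not at h
    obtain ⟨k, hk⟩ := h
    suffices (ordinaryHypergeometricSeries ℝ a b c).radius = ⊤ by simp [this]
    by_cases h1 : (k : ℝ) = -a
    · rw [show a = -(k : ℝ) by linarith, ordinaryHypergeometric_radius_top_of_neg_nat₁]
    by_cases h2 : (k : ℝ) = -b
    · rw [show b = -(k : ℝ) by linarith, ordinaryHypergeometric_radius_top_of_neg_nat₂]
    · rw [show c = -(k : ℝ) by linarith [hk h1 h2], ordinaryHypergeometric_radius_top_of_neg_nat₃]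

lemma enorm_lt_radius_ordinaryHypergeometricSeries (a b c : ℝ) {x : ℝ} (hx : |x| < 1) :
    ‖x‖ₑ < (ordinaryHypergeometricSeries ℝ a b c).radius := by
  refine lt_of_lt_of_le ?_ (one_le_radius_ordinaryHypergeometricSeries a b c)
  rw [← ofReal_norm, Real.norm_eq_abs]
  simpa using hx

lemma hasSum_ordinaryHypergeometric (a b c : ℝ) {x : ℝ} (hx : |x| < 1) :
    HasSum (fun n => ordinaryHypergeometricCoefficient a b c n * x ^ n)
      (ordinaryHypergeometric a b c x) := by
  have h := (ordinaryHypergeometricSeries ℝ a b c).hasSum (x := x)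
    (by simpa using enorm_lt_radius_ordinaryHypergeometricSeries a b c hx)
  simpa only [ordinaryHypergeometricSeries_apply_eq, smul_eq_mul] using! h

lemma hasDerivAt_ordinaryHypergeometric {c : ℝ} (hc : 0 < c) (a b : ℝ) {x : ℝ} (hx : |x| < 1) :
    HasDerivAt (ordinaryHypergeometric a b c)
      (a * b / c * ordinaryHypergeometric (a + 1) (b + 1) (c + 1) x) x := by
  set p := ordinaryHypergeometricSeries ℝ a b c with hp
  have hr := enorm_lt_radius_ordinaryHypergeometricSeries a b c hx
  have hd : HasDerivAt p.sum (p.derivSeries.sum x 1) x := (p.hasFDerivAt_sum hr).hasDerivAt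
  have hs := (p.derivSeries.hasSum (x := x)
    (by simpa using hr.trans_le p.radius_le_radius_derivSeries)).mapL
      (ContinuousLinearMap.apply ℝ ℝ (1 : ℝ))
  have hs' := (hasSum_ordinaryHypergeometric (a + 1) (b + 1) (c + 1) hx).mul_left (a * b / c)
  convert! hd using 1
  refine hs'.unique ?_
  convert! hs using 2 with n
  rw [← mul_assoc, ordinaryHypergeometricCoefficient_add_one hc]
  have hcoeff : p.coeff (n + 1) = ordinaryHypergeometricCoefficient a b c (n + 1) := by
    rw [hp, ordinaryHypergeometricSeries, FormalMultilinearSeries.coeff_ofScalars]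
  simp only [FormalMultilinearSeries.apply_eq_pow_smul_coeff, ContinuousLinearMap.apply_apply,
    smul_apply, FormalMultilinearSeries.derivSeries_coeff_one, hcoeff]
  simp
  ring

lemma hasSum_mul_pow_of_succ {s : ℕ → ℝ} {x S : ℝ} (h0 : s 0 = 0)
    (h : HasSum (fun n => s (n + 1) * x ^ n) S) : HasSum (fun n => s n * x ^ n) (x * S) := by
  rw [← hasSum_nat_add_iff' 1]
  convert! h.mul_left x using 1
  · ext n; ring
  · simp [h0]

/-- `x F' = ∑ n Cₙ xⁿ`. -/
lemma hasSum_mul_ordinaryHypergeometric_deriv {c : ℝ} (hc : 0 < c) (a b : ℝ) {x : ℝ}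
    (hx : |x| < 1) :
    HasSum (fun n : ℕ => (n * ordinaryHypergeometricCoefficient a b c n) * x ^ n)
      (x * (a * b / c * ordinaryHypergeometric (a + 1) (b + 1) (c + 1) x)) := by
  refine hasSum_mul_pow_of_succ (by simp) ?_
  convert! (hasSum_ordinaryHypergeometric (a + 1) (b + 1) (c + 1) hx).mul_left (a * b / c) using 2
    with n
  have e := ordinaryHypergeometricCoefficient_add_one hc a b n
  push_cast
  linear_combination -x ^ n * e

/-- The contiguous relation expressing `F'` through `F(a-1,b;c)` and `F(a,b;c)`. -/
lemma ordinaryHypergeometric_contiguous {c : ℝ} (hc : 0 < c) (a b : ℝ) {x : ℝ} (hx : |x| < 1) :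
    x * (1 - x) * (a * b / c * ordinaryHypergeometric (a + 1) (b + 1) (c + 1) x)
      = (c - a) * ordinaryHypergeometric (a - 1) b c x
        + (a - c + b * x) * ordinaryHypergeometric a b c x := by
  have hF := hasSum_ordinaryHypergeometric a b c hx
  have hD := hasSum_mul_ordinaryHypergeometric_deriv hc a b hx
  have hU := hasSum_ordinaryHypergeometric (a - 1) b c hx
  have h1 := (hD.add (hF.mul_left (c - a))).sub (hU.mul_left (c - a))
  -- The series of `h1` has no constant term; its coefficient at `n + 1` is `n + b` times the `n`-th
  -- coefficient of `F`.
  have h2 := hasSum_mul_pow_of_succ (x := x)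
    (s := fun n => (n + (c - a)) * ordinaryHypergeometricCoefficient a b c n
      - (c - a) * ordinaryHypergeometricCoefficient (a - 1) b c n)
    (by simp [ordinaryHypergeometricCoefficient_zero]) (S := _)
    (by
      convert! hD.add (hF.mul_left b) using 2 with n
      have e1 := ordinaryHypergeometricCoefficient_succ hc a b n
      have e2 := ordinaryHypergeometricCoefficient_sub_one_succ hc a b n
      have h3 : ((n : ℝ) + 1) * (c + n) ≠ 0 := by positivity
      apply mul_left_cancel₀ h3
      push_cast
      linear_combination x ^ n * ((n + 1 + (c - a)) * e1 - (c - a) * e2))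
  have h := h1.unique (h2.congr_fun fun n => by ring)
  linear_combination h

/-- The hypergeometric differential equation. -/
lemma ordinaryHypergeometric_ode {c : ℝ} (hc : 0 < c) (a b : ℝ) {x : ℝ} (hx : |x| < 1) :
    x * (1 - x) * (a * b / c * ((a + 1) * (b + 1) / (c + 1)
        * ordinaryHypergeometric (a + 1 + 1) (b + 1 + 1) (c + 1 + 1) x))
      + (c - (a + b + 1) * x) * (a * b / c * ordinaryHypergeometric (a + 1) (b + 1) (c + 1) x)
      = a * b * ordinaryHypergeometric a b c x := by
  have hF := hasSum_ordinaryHypergeometric a b c hx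
  have hD := hasSum_mul_ordinaryHypergeometric_deriv hc a b hx
  have hG := (hasSum_ordinaryHypergeometric (a + 1) (b + 1) (c + 1) hx).mul_left (a * b / c)
  have hDD := (hasSum_mul_ordinaryHypergeometric_deriv (by linarith : 0 < c + 1)
    (a + 1) (b + 1) hx).mul_left (a * b / c)
  have hDD' := hasSum_mul_pow_of_succ (x := x)
    (s := fun n => n * (n - 1) * ordinaryHypergeometricCoefficient a b c n) (by simp) (S := _)
    (by
      convert! hDD using 2 with n
      have e := ordinaryHypergeometricCoefficient_add_one hc a b n
      push_cast
      linear_combination -(n * x ^ n) * e)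
  have h := (((hDD.add (hG.mul_left c)).sub hDD').sub (hD.mul_left (a + b + 1))).sub
    (hF.mul_left (a * b))
  have h0 := h.unique (hasSum_zero.congr_fun fun n => by
    have e := ordinaryHypergeometricCoefficient_add_one hc a b n
    have e1 := ordinaryHypergeometricCoefficient_succ hc a b n
    linear_combination (n * x ^ n + c * x ^ n) * e + x ^ n * e1)
  linear_combination h0

/-! ### Asymptotics at the right end of the unit interval -/

/-- An Abelian theorem: if `pₙ / qₙ → l` and `∑ qₙ xⁿ → ∞` as `x → 1`, then the quotient of the
power series tends to `l` as well. -/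
lemma tendsto_div_powerSeries {p q : ℕ → ℝ} {P Q : ℝ → ℝ} {l : ℝ} (hq : ∀ n, 0 < q n)
    (hpq : Tendsto (fun n => p n / q n) atTop (𝓝 l))
    (hP : ∀ x ∈ Set.Ioo (0 : ℝ) 1, HasSum (fun n => p n * x ^ n) (P x))
    (hQ : ∀ x ∈ Set.Ioo (0 : ℝ) 1, HasSum (fun n => q n * x ^ n) (Q x))
    (hQtop : Tendsto Q (𝓝[<] 1) atTop) :
    Tendsto (fun x => P x / Q x) (𝓝[<] 1) (𝓝 l) := by
  rw [Metric.tendsto_nhds]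
  intro ε hε
  obtain ⟨N, hN⟩ := eventually_atTop.1 (Metric.tendsto_nhds.1 hpq (ε / 2) (half_pos hε))
  -- `M` bounds the head of the error series and is below `ε / 2 * Q x` once `Q` is large; the tail
  -- is at most `ε / 2 * Q x`.
  set M : ℝ := ∑ n ∈ Finset.range N, |p n - l * q n| with hM
  have hIoo : ∀ᶠ x in 𝓝[<] (1 : ℝ), x ∈ Set.Ioo (0 : ℝ) 1 := Ioo_mem_nhdsLT one_pos
  filter_upwards [hIoo, hQtop.eventually_gt_atTop (2 * M / ε), hQtop.eventually_gt_atTop 0]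
    with x hx hxM hx0
  have hterm : ∀ n, |(p n - l * q n) * x ^ n|
      ≤ (if n ∈ Finset.range N then |p n - l * q n| else 0) + ε / 2 * (q n * x ^ n) := by
    intro n
    have hxn : 0 < x ^ n := pow_pos hx.1 n
    have hxn1 : x ^ n ≤ 1 := pow_le_one₀ hx.1.le hx.2.le
    have hqx : 0 < q n * x ^ n := mul_pos (hq n) hxn
    rw [abs_mul, abs_of_pos hxn]
    split_ifs with h
    · nlinarith [abs_nonneg (p n - l * q n)]
    · have h1 := hN n (by simpa using h)
      rw [Real.dist_eq] at h1
      have h2 : |p n - l * q n| = |p n / q n - l| * q n := by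
        rw [← abs_of_pos (hq n), ← abs_mul, abs_of_pos (hq n), sub_mul,
          div_mul_cancel₀ _ (hq n).ne']
      rw [h2, zero_add, mul_assoc]
      exact mul_le_mul_of_nonneg_right h1.le hqx.le
  have hs1 : HasSum (fun n => (p n - l * q n) * x ^ n) (P x - l * Q x) :=
    ((hP x hx).sub ((hQ x hx).mul_left l)).congr_fun fun n => by ring
  have hs2 := (hasSum_sum_of_ne_finset_zero (s := Finset.range N)
    (f := fun n => if n ∈ Finset.range N then |p n - l * q n| else 0)
    (fun n hn => if_neg hn)).add ((hQ x hx).mul_left (ε / 2))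
  have hM' : ∑ n ∈ Finset.range N, (if n ∈ Finset.range N then |p n - l * q n| else 0) = M :=
    Finset.sum_congr rfl fun n hn => if_pos hn
  rw [hM'] at hs2
  have hub := hasSum_le (fun n => (le_abs_self _).trans (hterm n)) hs1 hs2
  have hlb := hasSum_le (fun n => (neg_le_abs _).trans (hterm n)) hs1.neg hs2
  rw [Real.dist_eq, div_sub' hx0.ne', abs_div, abs_of_pos hx0, div_lt_iff₀ hx0]
  rw [div_lt_iff₀ hε] at hxM
  rw [abs_lt]
  constructor <;> nlinarith

lemma GammaSeq_eq_ascPochhammer (s : ℝ) (n : ℕ) :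
    Real.GammaSeq s n = (n : ℝ) ^ s * n.factorial / (ascPochhammer ℝ (n + 1)).eval s := by
  rw [Real.GammaSeq]
  congr 1
  induction n + 1 with
  | zero => simp
  | succ k ih => rw [Finset.prod_range_succ, ih, ascPochhammer_succ_eval]

/-- In the quotient of Euler's products for `Γ`, the factorials cancel, and so do the powers of `n`
because `a + b = c + d`. -/
lemma tendsto_ascPochhammer_ratio {a b c d : ℝ} (ha : 0 < a) (hb : 0 < b) (hc : 0 < c) (hd : 0 < d)
    (h : a + b = c + d) :
    Tendsto (fun n => (ascPochhammer ℝ n).eval a * (ascPochhammer ℝ n).eval b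
      / ((ascPochhammer ℝ n).eval c * (ascPochhammer ℝ n).eval d)) atTop
      (𝓝 (Real.Gamma c * Real.Gamma d / (Real.Gamma a * Real.Gamma b))) := by
  rw [← tendsto_add_atTop_iff_nat 1]
  have key := ((Real.GammaSeq_tendsto_Gamma c).mul (Real.GammaSeq_tendsto_Gamma d)).div
    ((Real.GammaSeq_tendsto_Gamma a).mul (Real.GammaSeq_tendsto_Gamma b))
    (mul_pos (Real.Gamma_pos_of_pos ha) (Real.Gamma_pos_of_pos hb)).ne'
  refine key.congr' ?_
  filter_upwards [eventually_gt_atTop 0] with n hn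
  have hn' : (0 : ℝ) < n := by exact_mod_cast hn
  have hpow : (n : ℝ) ^ a * (n : ℝ) ^ b = (n : ℝ) ^ c * (n : ℝ) ^ d := by
    rw [← Real.rpow_add hn', ← Real.rpow_add hn', h]
  have h1 := (ascPochhammer_pos (n + 1) a ha).ne'
  have h2 := (ascPochhammer_pos (n + 1) b hb).ne'
  have h3 := (ascPochhammer_pos (n + 1) c hc).ne'
  have h4 := (ascPochhammer_pos (n + 1) d hd).ne'
  have h5 := (Real.rpow_pos_of_pos hn' a).ne'
  have h6 := (Real.rpow_pos_of_pos hn' b).ne'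
  have h7 : (n.factorial : ℝ) ≠ 0 := by positivity
  simp only [Pi.div_apply, GammaSeq_eq_ascPochhammer]
  field_simp
  linear_combination (-1 : ℝ) * hpow

lemma hasSum_one_sub_rpow_neg (c : ℝ) {x : ℝ} (hx : |x| < 1) :
    HasSum (fun n => (ascPochhammer ℝ n).eval c / n.factorial * x ^ n) ((1 - x) ^ (-c)) := by
  have h := (Real.one_div_one_sub_rpow_hasFPowerSeriesOnBall_zero c).hasSum (y := x) (by
    rw [Metric.mem_eball, edist_zero_right, ← ofReal_norm, Real.norm_eq_abs]
    simpa using hx)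
  have hx1 : 0 ≤ 1 - x := by linarith [(abs_lt.1 hx).2]
  rw [zero_add, one_div, ← Real.rpow_neg hx1] at h
  convert! h using 2 with n
  rw [FormalMultilinearSeries.ofScalars_apply_eq, smul_eq_mul, ← Ring.multichoose_eq]
  congr 1
  have h2 := Ring.factorial_nsmul_multichoose_eq_ascPochhammer c n
  rw [Polynomial.ascPochhammer_smeval_cast, Polynomial.ascPochhammer_smeval_eq_eval,
    nsmul_eq_mul] at h2
  rw [← h2]
  field_simp

lemma tendsto_one_sub_rpow_neg_atTop {c : ℝ} (hc : 0 < c) :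
    Tendsto (fun x : ℝ => (1 - x) ^ (-c)) (𝓝[<] 1) atTop := by
  have h1 : Tendsto (fun x : ℝ => 1 - x) (𝓝[<] 1) (𝓝[>] 0) := by
    refine tendsto_nhdsWithin_iff.2 ⟨?_, ?_⟩
    · have : Tendsto (fun x : ℝ => 1 - x) (𝓝 1) (𝓝 (1 - 1)) := by
        exact (continuous_const.sub continuous_id).tendsto 1
      rw [sub_self] at this
      exact this.mono_left nhdsWithin_le_nhds
    · filter_upwards [self_mem_nhdsWithin] with x hx
      simpa using hx
  exact (tendsto_rpow_neg_nhdsGT_zero (neg_lt_zero.2 hc)).comp h1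

lemma tendsto_one_sub_rpow_mul_ordinaryHypergeometric {a b c d l : ℝ} (hd : 0 < d)
    (hl : Tendsto (fun n => (ascPochhammer ℝ n).eval a * (ascPochhammer ℝ n).eval b
      / ((ascPochhammer ℝ n).eval c * (ascPochhammer ℝ n).eval d)) atTop (𝓝 l)) :
    Tendsto (fun x : ℝ => (1 - x) ^ d * ordinaryHypergeometric a b c x) (𝓝[<] 1) (𝓝 l) := by
  have habs : ∀ x ∈ Set.Ioo (0 : ℝ) 1, |x| < 1 := fun x hx => by
    rw [abs_of_pos hx.1]; exact hx.2
  have h := tendsto_div_powerSeries (p := ordinaryHypergeometricCoefficient a b c)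
    (q := fun n => (ascPochhammer ℝ n).eval d / n.factorial) (l := l)
    (fun n => div_pos (ascPochhammer_pos n d hd) (by positivity))
    (hl.congr fun n => by
      have h1 := (ascPochhammer_pos n d hd).ne'
      have h3 : (n.factorial : ℝ) ≠ 0 := by positivity
      rw [ordinaryHypergeometricCoefficient]
      field_simp)
    (fun x hx => hasSum_ordinaryHypergeometric a b c (habs x hx))
    (fun x hx => hasSum_one_sub_rpow_neg d (habs x hx)) (tendsto_one_sub_rpow_neg_atTop hd)
  refine h.congr' ?_
  filter_upwards [self_mem_nhdsWithin] with x hx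
  rw [Real.rpow_neg (sub_nonneg.2 (le_of_lt hx)), div_inv_eq_mul, mul_comm]

/-- The growth of `F(a,b;c;x)` as `x → 1` when `a + b > c`. -/
lemma tendsto_one_sub_rpow_mul_ordinaryHypergeometric_Gamma {a b c : ℝ} (ha : 0 < a) (hb : 0 < b)
    (hc : 0 < c) (h : c < a + b) :
    Tendsto (fun x : ℝ => (1 - x) ^ (a + b - c) * ordinaryHypergeometric a b c x) (𝓝[<] 1)
      (𝓝 (Real.Gamma c * Real.Gamma (a + b - c) / (Real.Gamma a * Real.Gamma b))) :=
  tendsto_one_sub_rpow_mul_ordinaryHypergeometric (sub_pos.2 h)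
    (tendsto_ascPochhammer_ratio ha hb hc (sub_pos.2 h) (by ring))

/-- The exponent exceeds `a + b - c` by one, which covers the logarithmic case `a + b = c` (that is,
`c = 1` in the theorem) without separate treatment. The coefficient ratio acquires a factor `a / (a
+ n)`, which tends to `0`. -/
lemma tendsto_one_sub_rpow_mul_ordinaryHypergeometric_zero {a b c : ℝ} (ha : 0 < a) (hb : 0 < b)
    (hc : 0 < c) (h : c < a + b + 1) :
    Tendsto (fun x : ℝ => (1 - x) ^ (a + b + 1 - c) * ordinaryHypergeometric a b c x) (𝓝[<] 1)
      (𝓝 0) := by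
  refine tendsto_one_sub_rpow_mul_ordinaryHypergeometric (sub_pos.2 h) ?_
  have h1 := tendsto_ascPochhammer_ratio (a := a + 1) (by linarith) hb hc (sub_pos.2 h) (by ring)
  have h2 : Tendsto (fun n : ℕ => a / (a + n)) atTop (𝓝 0) :=
    tendsto_const_nhds.div_atTop (tendsto_atTop_add_const_left _ _ tendsto_natCast_atTop_atTop)
  have h3 := h1.mul h2
  rw [mul_zero] at h3
  refine h3.congr fun n => ?_
  have e := ascPochhammer_eval_add_one n a
  have h4 : a + n ≠ 0 := by positivity
  rw [div_mul_div_comm, mul_comm _ a, ← mul_assoc, e]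
  field_simp

/-! ### The Wronskian of `F(z)` and `F(1 - z)` -/

/-- The Wronskian `F'(z) F(1-z) + F(z) F'(1-z)` of `F(z) = F(a,b;c;z)` and `F(1-z)`. -/
noncomputable def hypWronskian (a b c z : ℝ) : ℝ :=
  a * b / c * ordinaryHypergeometric (a + 1) (b + 1) (c + 1) z * ordinaryHypergeometric a b c (1 - z)
    + ordinaryHypergeometric a b c z
      * (a * b / c * ordinaryHypergeometric (a + 1) (b + 1) (c + 1) (1 - z))

lemma abs_lt_one_of_mem_Ioo {z : ℝ} (hz : z ∈ Set.Ioo (0 : ℝ) 1) : |z| < 1 ∧ |1 - z| < 1 := by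
  obtain ⟨h0, h1⟩ := hz
  constructor <;> rw [abs_lt] <;> constructor <;> linarith

/-- Adding the contiguous relations at `z` and `1 - z`, the product `F(z) F(1 - z)` gets the
coefficient `2 * a - 2 * c + b = a - 1`. -/
lemma legendreForm_eq_hypWronskian {a b c : ℝ} (hc : 0 < c) (habc : 2 * c = a + b + 1) {z : ℝ}
    (hz : z ∈ Set.Ioo (0 : ℝ) 1) :
    legendreForm a b c z = z * (1 - z) * hypWronskian a b c z := by
  obtain ⟨h0, h1⟩ := abs_lt_one_of_mem_Ioo hz
  have e0 := ordinaryHypergeometric_contiguous hc a b h0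
  have e1 := ordinaryHypergeometric_contiguous hc a b h1
  simp only [legendreForm, hypU, hypV, hypWronskian]
  set F := ordinaryHypergeometric a b c z
  set F₁ := ordinaryHypergeometric a b c (1 - z)
  linear_combination (-F₁) * e0 - F * e1 + F * F₁ * habc

/-- Abel's identity: in the combination of the two differential equations, the terms `a * b * F(z) *
F(1 - z)` cancel. -/
lemma hasDerivAt_rpow_mul_hypWronskian {a b c : ℝ} (hc : 0 < c) (habc : 2 * c = a + b + 1)
    {z : ℝ} (hz : z ∈ Set.Ioo (0 : ℝ) 1) :
    HasDerivAt (fun z => z ^ c * (1 - z) ^ c * hypWronskian a b c z) 0 z := by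
  obtain ⟨h0, h1⟩ := abs_lt_one_of_mem_Ioo hz
  have hz0 : 0 < z := hz.1
  have hz1 : 0 < 1 - z := sub_pos.2 hz.2
  have e0 := ordinaryHypergeometric_ode hc a b h0
  have e1 := ordinaryHypergeometric_ode hc a b h1
  have hsub : HasDerivAt (fun z : ℝ => 1 - z) (-1) z := by
    simpa using (hasDerivAt_id z).const_sub 1
  have dF := hasDerivAt_ordinaryHypergeometric hc a b h0
  have dF₁ := (hasDerivAt_ordinaryHypergeometric hc a b h1).comp z hsub
  have hc1 : 0 < c + 1 := by linarith
  have dG := (hasDerivAt_ordinaryHypergeometric hc1 (a + 1) (b + 1) h0).const_mul (a * b / c)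
  have dG₁ := ((hasDerivAt_ordinaryHypergeometric hc1 (a + 1) (b + 1) h1).comp z hsub).const_mul
    (a * b / c)
  have dz := Real.hasDerivAt_rpow_const (x := z) (p := c) (Or.inl hz0.ne')
  have dz₁ := hsub.rpow_const (p := c) (Or.inl hz1.ne')
  have key := (dz.mul dz₁).mul ((dG.mul dF₁).add (dF.mul dG₁))
  convert! key using 1
  simp only [Function.comp_apply]
  have r0 : z ^ c = z ^ (c - 1) * z := by
    rw [Real.rpow_sub_one hz0.ne', div_mul_cancel₀ _ hz0.ne']
  have r1 : (1 - z) ^ c = (1 - z) ^ (c - 1) * (1 - z) := by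
    rw [Real.rpow_sub_one hz1.ne', div_mul_cancel₀ _ hz1.ne']
  simp only [Pi.mul_apply, Pi.add_apply, Function.comp_apply, r0, r1]
  rw [← habc] at e0 e1
  set F := ordinaryHypergeometric a b c z
  set F₁ := ordinaryHypergeometric a b c (1 - z)
  linear_combination (-z ^ (c - 1) * (1 - z) ^ (c - 1)) * (F₁ * e0 - F * e1)

/-- Only `F(z) F'(1 - z)` survives as `z → 0`: `F'(1 - z)` grows like `z ^ (-c)`, while `F(1 - z)`
is of smaller order. -/
lemma tendsto_rpow_mul_hypWronskian {a b c : ℝ} (ha : 0 < a) (hb : 0 < b) (hc : 0 < c)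
    (habc : 2 * c = a + b + 1) :
    Tendsto (fun z => z ^ c * (1 - z) ^ c * hypWronskian a b c z) (𝓝[>] 0)
      (𝓝 (Real.Gamma c ^ 2 / (Real.Gamma a * Real.Gamma b))) := by
  have hsub : Tendsto (fun z : ℝ => 1 - z) (𝓝[>] 0) (𝓝[<] 1) := by
    refine tendsto_nhdsWithin_iff.2 ⟨?_, ?_⟩
    · have : Tendsto (fun x : ℝ => 1 - x) (𝓝 0) (𝓝 (1 - 0)) :=
        (continuous_const.sub continuous_id).tendsto 0
      rw [sub_zero] at this
      exact this.mono_left nhdsWithin_le_nhds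
    · filter_upwards [self_mem_nhdsWithin] with x hx
      simpa using hx
  have hcont : ∀ a b c : ℝ, 0 < c → Tendsto (ordinaryHypergeometric a b c : ℝ → ℝ) (𝓝[>] 0) (𝓝 1) := by
    intro a b c hc
    have h := (hasDerivAt_ordinaryHypergeometric hc a b (x := 0) (by simp)).continuousAt.tendsto
    rw [ordinaryHypergeometric_zero] at h
    exact h.mono_left nhdsWithin_le_nhds
  have hpow : Tendsto (fun z : ℝ => (1 - z) ^ c) (𝓝[>] 0) (𝓝 1) := by
    have h : Tendsto (fun z : ℝ => (1 - z) ^ c) (𝓝 0) (𝓝 ((1 - 0) ^ c)) :=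
      ((continuous_const.sub continuous_id).continuousAt.rpow_const (Or.inr hc.le)).tendsto
    rw [sub_zero, Real.one_rpow] at h
    exact h.mono_left nhdsWithin_le_nhds
  have hF₁ := (tendsto_one_sub_rpow_mul_ordinaryHypergeometric_zero ha hb hc (by linarith)).comp hsub
  have hG₁ := (tendsto_one_sub_rpow_mul_ordinaryHypergeometric_Gamma (a := a + 1) (b := b + 1)
    (c := c + 1) (by linarith) (by linarith) (by linarith) (by linarith)).comp hsub
  rw [show a + b + 1 - c = c by linarith] at hF₁
  rw [show a + 1 + (b + 1) - (c + 1) = c by linarith, Real.Gamma_add_one ha.ne',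
    Real.Gamma_add_one hb.ne', Real.Gamma_add_one hc.ne'] at hG₁
  have key := hpow.mul ((((hcont (a + 1) (b + 1) (c + 1) (by linarith)).const_mul (a * b / c)).mul
    hF₁).add ((hcont a b c hc).mul (hG₁.const_mul (a * b / c))))
  have hga := (Real.Gamma_pos_of_pos ha).ne'
  have hgb := (Real.Gamma_pos_of_pos hb).ne'
  convert! key using 1
  · ext z
    simp only [Function.comp_apply, hypWronskian, sub_sub_cancel]
    ring
  · congr 1
    field_simp
    ring

theorem rpow_mul_hypWronskian_eq {a b c : ℝ} (ha : 0 < a) (hb : 0 < b) (hc : 0 < c)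
    (habc : 2 * c = a + b + 1) {z : ℝ} (hz : z ∈ Set.Ioo (0 : ℝ) 1) :
    z ^ c * (1 - z) ^ c * hypWronskian a b c z
      = Real.Gamma c ^ 2 / (Real.Gamma a * Real.Gamma b) := by
  have hd := fun z hz => hasDerivAt_rpow_mul_hypWronskian (a := a) (b := b) hc habc (z := z) hz
  obtain ⟨A, hA⟩ := isOpen_Ioo.exists_is_const_of_deriv_eq_zero isPreconnected_Ioo
    (fun x hx => (hd x hx).differentiableAt.differentiableWithinAt) (fun x hx => (hd x hx).deriv)
  rw [hA z hz]
  refine tendsto_nhds_unique (tendsto_const_nhds.congr' ?_)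
    (tendsto_rpow_mul_hypWronskian ha hb hc habc)
  filter_upwards [Ioo_mem_nhdsGT (one_pos : (0 : ℝ) < 1)] with x hx using (hA x hx).symm

/-! ### The identity and Legendre's relation -/

theorem legendreForm_eq {a b c : ℝ} (ha : 0 < a) (hb : 0 < b) (hc : 0 < c)
    (habc : 2 * c = a + b + 1) {z : ℝ} (hz : z ∈ Set.Ioo (0 : ℝ) 1) :
    legendreForm a b c z = Real.Gamma c ^ 2 / (Real.Gamma a * Real.Gamma b)
      * (z ^ (1 - c) * (1 - z) ^ (1 - c)) := by
  have hz0 : 0 < z := hz.1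
  have hz1 : 0 < 1 - z := sub_pos.2 hz.2
  have h0 := (Real.rpow_pos_of_pos hz0 c).ne'
  have h1 := (Real.rpow_pos_of_pos hz1 c).ne'
  rw [legendreForm_eq_hypWronskian hc habc hz, ← rpow_mul_hypWronskian_eq ha hb hc habc hz,
    Real.rpow_sub hz0, Real.rpow_sub hz1, Real.rpow_one, Real.rpow_one]
  field_simp

lemma legendreForm_sq_eq_genLegendre (a : ℝ) {r : ℝ} (hr : r ∈ Set.Ioo (0 : ℝ) 1) :
    legendreForm a (1 - a) 1 (r ^ 2) = (1 - a) * (2 / Real.pi) ^ 2 * genLegendre a r := by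
  have hs : Real.sqrt (1 - r ^ 2) ^ 2 = 1 - r ^ 2 :=
    Real.sq_sqrt (by nlinarith [hr.1, hr.2])
  have hpi := Real.pi_ne_zero
  simp only [legendreForm, hypU, hypV, genLegendre, genEllipticK, genEllipticE, hs]
  field_simp
  ring

theorem lemma4p5 (a b c : ℝ) (ha : 0 < a) (hb : 0 < b) (hc : 1 ≤ c) (habc : 2 * c = a + b + 1) :
    -- a constant `A` satisfies the identity on `(0,1)` if and only if it has the stated value
    (∀ A : ℝ,
      (∀ z ∈ Set.Ioo (0 : ℝ) 1,
        legendreForm a b c z = A * (z ^ (1 - c) * (1 - z) ^ (1 - c))) ↔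
      A = Real.Gamma c ^ 2 / (Real.Gamma a * Real.Gamma b)) ∧
    -- for `c = 1` the left side at `z = r²` is a multiple of that of Legendre's relation,
    -- and Legendre's relation for generalized elliptic integrals holds
    (c = 1 → ∀ r ∈ Set.Ioo (0 : ℝ) 1,
      legendreForm a b c (r ^ 2) = (1 - a) * (2 / Real.pi) ^ 2 * genLegendre a r ∧
      genLegendre a r = Real.pi * Real.sin (Real.pi * a) / (4 * (1 - a))) := by
  have hc0 : 0 < c := by linarith
  refine ⟨fun A => ⟨fun h => ?_, ?_⟩, ?_⟩
  -- One point determines `A`, since the weight multiplying it is positive.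
  · have hmem : (1 / 2 : ℝ) ∈ Set.Ioo (0 : ℝ) 1 := by constructor <;> norm_num
    have h2 := (h _ hmem).symm.trans (legendreForm_eq ha hb hc0 habc hmem)
    refine mul_right_cancel₀ (ne_of_gt ?_) h2
    exact mul_pos (Real.rpow_pos_of_pos hmem.1 _) (Real.rpow_pos_of_pos (sub_pos.2 hmem.2) _)
  · rintro rfl z hz
    exact legendreForm_eq ha hb hc0 habc hz
  · rintro rfl r hr
    obtain rfl : b = 1 - a := by linarith
    have hr2 : r ^ 2 ∈ Set.Ioo (0 : ℝ) 1 :=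
      ⟨pow_pos hr.1 2, pow_lt_one₀ hr.1.le hr.2 two_ne_zero⟩
    have h1 := legendreForm_sq_eq_genLegendre a hr
    refine ⟨h1, ?_⟩
    have h2 := legendreForm_eq ha hb hc0 habc hr2
    rw [h1, sub_self, Real.rpow_zero, Real.rpow_zero, Real.Gamma_one,
      Real.Gamma_mul_Gamma_one_sub] at h2
    have hpi := Real.pi_ne_zero
    field_simp at h2 ⊢
    linear_combination h2
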